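/- Let $n\ge 1$. A body is a compact convex set $K\subset\mathbb R^n$ with $0\in\operatorname{int}K$. For a body $K$ let $h_K(a)=\sup_{x\in K}a^Tx$ be its support function and $\|x\|_K=\inf\{\lambda\ge 0: x\in\lambda K\}$ its gauge. Its Minkowski asymmetry is $s(K)=\inf\{\lambda\ge 0: K\subset -\lambda K+c \text{ for some } c\in\mathbb R^n\}$; $K$ is Minkowski centered if $K\subset -s(K)K$, and $0$-symmetric if $K=-K$. The Banach–Mazur distance of bodies is $$d_{BM}(K,L)=\inf\{\lambda\ge 0: K+t^1\subset AL\subset\lambda K+t^2,\ A\in\mathbb R^{n\times n}\text{ regular},\ t^1,t^2\in\mathbb R^n\}.$$ For $\alpha,\beta>0$ and $p\in\mathbb R$ let $m_p(\alpha,\beta)=\left(\frac{\alpha^p+\beta^p}{2}\right)^{1/p}$ if $p\ne 0$ and $m_0(\alpha,\beta)=\sqrt{\alpha\beta}$. With the Euclidean unit sphere $\mathbb S$, the upper and lower $p$-means of bodies $K,L$ are $$\overline M_p(K,L)=\{x\in\mathbb R^n: a^Tx\le m_p(h_K(a),h_L(a))\ \text{for all } a\in\mathbb S\},\qquad \underline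 M_p(K,L)=\operatorname{conv}\{m_{-p}(\|x\|_K,\|x\|_L)^{-1}x: x\in\mathbb S\}.$$ Put $U_0=K$, $V_0=L$, $U_{i+1}=\overline M_p(U_i,V_i)$ and $V_{i+1}=\underline M_{-p}(U_i,V_i)$ for $i\ge 0$. The mean $G_p(K,L)$ is the common limit of $(U_i)$ and $(V_i)$ in the Hausdorff distance. Then for all bodies $K,L\subset\mathbb R^n$ and all $p\in\mathbb R$, this common limit exists and is a body (in particular for $L=-K$), and: (P10) $G_p(K,-K)$ is $0$-symmetric. (P11) If $K$ is Minkowski centered, then $d_{BM}(K,G_p(K,-K))=s(K)$. (P12) If $K$ and $L$ are Minkowski centered, then $s(G_p(K,L))\le\max\{s(K),s(L)\}$, and if equality holds, then $G_p(K,L)$ is Minkowski centered. In particular, if $K$ and $L$ are $0$-symmetric, then so is $G_p(K,L)$. -/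

import Mathlib

open Filter Topology
open scoped Pointwise

noncomputable section

namespace ConvexMeans

/-- `n`-dimensional Euclidean space. -/
abbrev E (n : ℕ) : Type := EuclideanSpace ℝ (Fin n)

variable {n : ℕ}

/-- `K` is a convex body (compact, convex) that contains the origin in its interior. -/
structure IsBody₀ (K : Set (E n)) : Prop where
  convex : Convex ℝ K
  isCompact : IsCompact K
  zero_mem_interior : (0 : E n) ∈ interior K

/-- The circumradius `R(K, C) = inf {r ≥ 0 : K ⊆ r C + c for some c}`. -/
def circumradius (K C : Set (E n)) : ℝ :=
  sInf {r : ℝ | 0 ≤ r ∧ ∃ c : E n, K ⊆ r • C + {c}}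

/-- The Minkowski asymmetry `s(K) = R(K, -K)`. -/
def asymmetry (K : Set (E n)) : ℝ := circumradius K (-K)

/-- `K` is Minkowski centered if `K ⊆ -s(K) K`. -/
def IsMinkowskiCentered (K : Set (E n)) : Prop := K ⊆ (-asymmetry K) • K

/-- `K` is `0`-symmetric if `K = -K`. -/
def IsZeroSymmetric (K : Set (E n)) : Prop := K = -K

/-- The (affine) Banach-Mazur distance: the infimum of all `r ≥ 0` with
`K + t₁ ⊆ A L ⊆ r K + t₂` for some invertible linear map `A` and translations `t₁`, `t₂`. -/
def banachMazurDist (K L : Set (E n)) : ℝ :=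
  sInf {r : ℝ | 0 ≤ r ∧ ∃ (A : E n ≃ₗ[ℝ] E n) (t₁ t₂ : E n),
    K + {t₁} ⊆ A '' L ∧ A '' L ⊆ r • K + {t₂}}

/-- The `p`-mean of two positive reals for a real parameter `p`; the geometric mean if `p = 0`. -/
def pMean (p a b : ℝ) : ℝ :=
  if p = 0 then √(a * b) else ((a ^ p + b ^ p) / 2) ^ (1 / p)

/-- The support function `h_C(a) = sup {⟪a, x⟫ : x ∈ C}` (finite, as `C` is used bounded). -/
def supportFn (C : Set (E n)) (a : E n) : ℝ :=
  sSup ((fun x => inner ℝ a x) '' C)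

/-- The upper `p`-mean of two convex bodies, an intersection of halfspaces. -/
def upperMean (p : ℝ) (K L : Set (E n)) : Set (E n) :=
  {x | ∀ a ∈ Metric.sphere (0 : E n) 1,
    inner ℝ a x ≤ pMean p (supportFn K a) (supportFn L a)}

/-- The lower `p`-mean of two convex bodies, a convex hull. Here `gauge K x` is Mathlib's
Minkowski functional `inf {r > 0 : x ∈ r K}`. -/
def lowerMean (p : ℝ) (K L : Set (E n)) : Set (E n) :=
  convexHull ℝ ((fun x => (pMean (-p) (gauge K x) (gauge L x))⁻¹ • x) ''
    Metric.sphere (0 : E n) 1)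

/-- The iteration of upper `p`-means and lower `(-p)`-means. It starts with `(K, L)`;
step `1` is the pair of the upper `p`-mean and the lower `(-p)`-mean of `K` and `L`. -/
def iterMeans (p : ℝ) (K L : Set (E n)) : ℕ → Set (E n) × Set (E n)
  | 0 => (K, L)
  | i + 1 =>
    (upperMean p (iterMeans p K L i).1 (iterMeans p K L i).2,
      lowerMean (-p) (iterMeans p K L i).1 (iterMeans p K L i).2)

/-- `G` is a convex body with the origin in its interior, and both sequences of iterated means
converge to `G` in the Hausdorff distance. -/
structure IsCommonLimit (p : ℝ) (K L G : Set (E n)) : Prop where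
  isBody₀ : IsBody₀ G
  tendsto_upper :
    Tendsto (fun i => Metric.hausdorffEDist (iterMeans p K L i).1 G) atTop (𝓝 0)
  tendsto_lower :
    Tendsto (fun i => Metric.hausdorffEDist (iterMeans p K L i).2 G) atTop (𝓝 0)

open Classical in
/-- The mean `G_p(K, L)`: the common Hausdorff limit of the two sequences of iterated means. Such a
limit is unique; the value `∅` is a placeholder for the case that there is none. -/
def geomMean (p : ℝ) (K L : Set (E n)) : Set (E n) :=
  if h : ∃ G : Set (E n), IsCommonLimit p K L G then h.choose else ∅

end ConvexMeans

end

/-!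
The iteration contracts multiplicatively. Let `U`, `V` be bodies with `U ⊆ r V` and `V ⊆ r U`, and
write `m` for `pMean p`. Since means are monotone and the means of `b K` and `c K` are multiples of
`K`, the upper mean of `U`, `V` lies in `m(1, r) U` and in `m(1, r) V`, and the lower `(-p)`-mean,
whose spanning points are normalized by the `p`-mean of the gauges, lies in `(r / m(1, r)) U` and in
`(r / m(1, r)) V`. Both contain `U ∩ V`, so the new ratio is at most
`max (m(1, r)) (r / m(1, r))` (`means_subset_smul_inter`). This is less than `r` for `r > 1`, and so
the ratios tend to `1` (`tendsto_iterate_ratioStep`). The upper mean need not contain the lower one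
if `p < 0`, so the sequences themselves need not be monotone. But the bodies `Uᵢ ∩ Vᵢ` increase and
the bodies `conv (Uᵢ ∪ Vᵢ)` decrease, and their ratio tends to `1`; the intersection of the latter
is the common limit (`exists_isRatioLimit_iterMeans`, `geomMean_spec`).

The remaining claims are inclusions that hold along the iteration and pass to the limit.
* The means of `K` and `-K` are symmetric from the first step on, because both means are symmetric
  in their arguments and commute with reflection in the origin.
* The inclusions `U ⊆ -s U` and `V ⊆ -s V` are inherited by both means
  (`iterMeans_subset_smul_neg`), and so by the limit.
* If `K ⊆ -s K`, the means of `K` and `-K` lie between `d K` and `s d K`, and between `e K` and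
  `s e K`, with `d e = 1 / s` throughout (`exists_iterMeans_neg_sandwich`), because one step on
  `(d, e)` preserves the product. Hence the limit lies between `K / √s` and `√s K`
  (`geomMean_neg_sandwich`), which bounds the Banach–Mazur distance by `s`. Conversely, no symmetric
  set is closer to `K` than `s(K)` (`asymmetry_le_of_isZeroSymmetric`).
-/

namespace ConvexMeans

/-! ### Means of positive reals -/

theorem pMean_comm (p a b : ℝ) : pMean p a b = pMean p b a := by
  simp only [pMean, mul_comm a b, add_comm (a ^ p)]

theorem pMean_pos (p : ℝ) {a b : ℝ} (ha : 0 < a) (hb : 0 < b) : 0 < pMean p a b := by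
  unfold pMean
  split_ifs <;> positivity

theorem pMean_self (p : ℝ) {a : ℝ} (ha : 0 < a) : pMean p a a = a := by
  unfold pMean
  split_ifs with hp
  · exact Real.sqrt_mul_self ha.le
  · rw [add_self_div_two, one_div, Real.rpow_rpow_inv ha.le hp]

theorem pMean_mul (p : ℝ) {c a b : ℝ} (hc : 0 < c) (ha : 0 ≤ a) (hb : 0 ≤ b) :
    pMean p (c * a) (c * b) = c * pMean p a b := by
  unfold pMean
  split_ifs with hp
  · rw [mul_mul_mul_comm, Real.sqrt_mul (by positivity), Real.sqrt_mul_self hc.le]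
  · rw [Real.mul_rpow hc.le ha, Real.mul_rpow hc.le hb, ← mul_add, mul_div_assoc,
      Real.mul_rpow (by positivity) (by positivity), one_div, Real.rpow_rpow_inv hc.le hp]

theorem pMean_mono (p : ℝ) {a b a' b' : ℝ} (ha : 0 < a) (hb : 0 < b) (haa : a ≤ a')
    (hbb : b ≤ b') : pMean p a b ≤ pMean p a' b' := by
  have ha' := ha.trans_le haa
  have hb' := hb.trans_le hbb
  unfold pMean
  split_ifs with hp
  · gcongr
  · rcases lt_or_gt_of_ne hp with h | h
    · have h1 := Real.rpow_le_rpow_of_nonpos ha haa h.le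
      have h2 := Real.rpow_le_rpow_of_nonpos hb hbb h.le
      refine Real.rpow_le_rpow_of_nonpos (by positivity) (by linarith) ?_
      exact (one_div_neg.2 h).le
    · have h1 := Real.rpow_le_rpow ha.le haa h.le
      have h2 := Real.rpow_le_rpow hb.le hbb h.le
      exact Real.rpow_le_rpow (by positivity) (by linarith) (by positivity)

theorem one_lt_pMean (p : ℝ) {r : ℝ} (hr : 1 < r) : 1 < pMean p 1 r := by
  have hr0 : 0 < r := by linarith
  unfold pMean
  split_ifs with hp
  · rw [one_mul]
    exact Real.lt_sqrt_of_sq_lt (by simpa using hr)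
  · rw [Real.one_rpow]
    rcases lt_or_gt_of_ne hp with h | h
    · have h1 := Real.rpow_lt_one_of_one_lt_of_neg hr h
      exact Real.one_lt_rpow_of_pos_of_lt_one_of_neg (by positivity) (by linarith)
        (one_div_neg.2 h)
    · have h1 := Real.one_lt_rpow hr h
      exact Real.one_lt_rpow (by linarith) (by positivity)

theorem pMean_lt (p : ℝ) {r : ℝ} (hr : 1 < r) : pMean p 1 r < r := by
  have hr0 : 0 < r := by linarith
  have hi : r⁻¹ < 1 := inv_lt_one_of_one_lt₀ hr
  unfold pMean
  split_ifs with hp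
  · rw [one_mul, Real.sqrt_lt' hr0]
    nlinarith
  · rw [Real.one_rpow]
    rcases lt_or_gt_of_ne hp with h | h
    · have h1 := Real.rpow_lt_one_of_one_lt_of_neg hr h
      calc ((1 + r ^ p) / 2) ^ (1 / p) < (r ^ p) ^ (1 / p) :=
            Real.rpow_lt_rpow_of_neg (by positivity) (by linarith) (one_div_neg.2 h)
        _ = r := by rw [one_div, Real.rpow_rpow_inv hr0.le hp]
    · have h1 := Real.one_lt_rpow hr h
      calc ((1 + r ^ p) / 2) ^ (1 / p) < (r ^ p) ^ (1 / p) :=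
            Real.rpow_lt_rpow (by positivity) (by linarith) (by positivity)
        _ = r := by rw [one_div, Real.rpow_rpow_inv hr0.le hp]

theorem continuousOn_pMean (p : ℝ) :
    ContinuousOn (fun q : ℝ × ℝ => pMean p q.1 q.2) {q | 0 < q.1 ∧ 0 < q.2} := by
  unfold pMean
  split_ifs with hp
  · exact (Real.continuous_sqrt.comp (continuous_fst.mul continuous_snd)).continuousOn
  · refine ContinuousOn.rpow_const (ContinuousOn.div_const (ContinuousOn.add
      (ContinuousOn.rpow_const continuousOn_fst fun q hq => Or.inl hq.1.ne')
      (ContinuousOn.rpow_const continuousOn_snd fun q hq => Or.inl hq.2.ne')) _) ?_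
    rintro q ⟨h1, h2⟩
    left
    positivity

/-- One step of the iteration preserves the product of two reals. For multiples `d K` and `e K` of
one body, the factors of the upper and the lower mean are the ones on the left. -/
theorem pMean_mul_inv_pMean_inv (p : ℝ) {d e : ℝ} (hd : 0 < d) (he : 0 < e) :
    pMean p d e * (pMean p d⁻¹ e⁻¹)⁻¹ = d * e := by
  have h : pMean p d e = d * e * pMean p d⁻¹ e⁻¹ := by
    rw [← pMean_mul p (by positivity) (by positivity) (by positivity), pMean_comm]
    congr 1 <;> field_simp
  rw [h, mul_inv_cancel_right₀ (pMean_pos p (by positivity) (by positivity)).ne']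

theorem pMean_one_inv (p : ℝ) {r : ℝ} (hr : 0 < r) : pMean p 1 r⁻¹ = r⁻¹ * pMean p 1 r := by
  rw [← pMean_mul p (by positivity) zero_le_one hr.le, mul_one, inv_mul_cancel₀ hr.ne',
    pMean_comm]

/-- The effect of one step of the iteration on a ratio `r` with `U ⊆ r V` and `V ⊆ r U`: the two
means contain each other up to the factor `ratioStep p r`. -/
noncomputable def ratioStep (p r : ℝ) : ℝ := max (pMean p 1 r) (r / pMean p 1 r)

theorem one_le_ratioStep (p : ℝ) {r : ℝ} (hr : 1 ≤ r) : 1 ≤ ratioStep p r := by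
  refine le_max_of_le_left ?_
  rcases hr.eq_or_lt with rfl | h
  · exact (pMean_self p one_pos).ge
  · exact (one_lt_pMean p h).le

theorem ratioStep_lt (p : ℝ) {r : ℝ} (hr : 1 < r) : ratioStep p r < r :=
  max_lt (pMean_lt p hr) (div_lt_self (by linarith) (one_lt_pMean p hr))

theorem ratioStep_one (p : ℝ) : ratioStep p 1 = 1 := by
  simp [ratioStep, pMean_self p one_pos]

theorem continuousAt_ratioStep (p : ℝ) {r : ℝ} (hr : 0 < r) : ContinuousAt (ratioStep p) r := by
  have h : ContinuousAt (fun t : ℝ => pMean p 1 t) r := by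
    have ho : IsOpen {q : ℝ × ℝ | 0 < q.1 ∧ 0 < q.2} :=
      (isOpen_lt continuous_const continuous_fst).inter
        (isOpen_lt continuous_const continuous_snd)
    have h2 := (continuousOn_pMean p).continuousAt (ho.mem_nhds (x := ((1 : ℝ), r)) ⟨one_pos, hr⟩)
    exact h2.comp (f := fun t : ℝ => ((1 : ℝ), t)) (by fun_prop)
  exact h.max (continuousAt_id.div h (pMean_pos p one_pos hr).ne')

theorem one_le_iterate_ratioStep (p : ℝ) {r : ℝ} (hr : 1 ≤ r) (i : ℕ) :
    1 ≤ (ratioStep p)^[i] r := by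
  induction i with
  | zero => exact hr
  | succ i ih =>
    rw [Function.iterate_succ_apply']
    exact one_le_ratioStep p ih

/-- The ratios decrease to a fixed point of `ratioStep`, and `1` is the only one. -/
theorem tendsto_iterate_ratioStep (p : ℝ) {r : ℝ} (hr : 1 ≤ r) :
    Tendsto (fun i => (ratioStep p)^[i] r) atTop (𝓝 1) := by
  have h1 := one_le_iterate_ratioStep p hr
  have hanti : Antitone fun i => (ratioStep p)^[i] r := by
    refine antitone_nat_of_succ_le fun i => ?_
    rw [Function.iterate_succ_apply']
    rcases (h1 i).eq_or_lt with h | h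
    · rw [← h, ratioStep_one]
    · exact (ratioStep_lt p h).le
  have hbdd : BddBelow (Set.range fun i => (ratioStep p)^[i] r) :=
    ⟨1, by rintro _ ⟨i, rfl⟩; exact h1 i⟩
  have ht := tendsto_atTop_ciInf hanti hbdd
  set l := ⨅ i, (ratioStep p)^[i] r
  have hl : 1 ≤ l := le_ciInf h1
  have hfix : ratioStep p l = l :=
    isFixedPt_of_tendsto_iterate ht (continuousAt_ratioStep p (by linarith))
  rcases hl.eq_or_lt with h | h
  · rwa [← h] at ht
  · exact absurd hfix (ratioStep_lt p h).ne

/-! ### Support functions and gauges of convex bodies -/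

variable {n : ℕ} {K L G U V U₂ V₂ : Set (E n)} {a x : E n} {b c r s : ℝ}

namespace IsBody₀

theorem mem_nhds (hK : IsBody₀ K) : K ∈ 𝓝 (0 : E n) :=
  mem_interior_iff_mem_nhds.1 hK.zero_mem_interior

theorem zero_mem (hK : IsBody₀ K) : (0 : E n) ∈ K := mem_of_mem_nhds hK.mem_nhds

theorem absorbent (hK : IsBody₀ K) : Absorbent ℝ K := absorbent_nhds_zero hK.mem_nhds

theorem of_mem_nhds (h1 : Convex ℝ K) (h2 : IsCompact K) (h3 : K ∈ 𝓝 (0 : E n)) : IsBody₀ K :=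
  ⟨h1, h2, mem_interior_iff_mem_nhds.2 h3⟩

theorem smul (hK : IsBody₀ K) (hc : 0 < c) : IsBody₀ (c • K) :=
  of_mem_nhds (hK.convex.smul c) (hK.isCompact.smul c)
    ((set_smul_mem_nhds_zero_iff hc.ne').2 hK.mem_nhds)

theorem neg (hK : IsBody₀ K) : IsBody₀ (-K) :=
  of_mem_nhds hK.convex.neg hK.isCompact.neg (by simpa using neg_mem_nhds_zero (E n) hK.mem_nhds)

theorem inter (hK : IsBody₀ K) (hL : IsBody₀ L) : IsBody₀ (K ∩ L) :=
  of_mem_nhds (hK.convex.inter hL.convex) (hK.isCompact.inter hL.isCompact)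
    (inter_mem hK.mem_nhds hL.mem_nhds)

theorem inner_le_supportFn (hK : IsBody₀ K) (hx : x ∈ K) (a : E n) :
    inner ℝ a x ≤ supportFn K a :=
  le_csSup (hK.isCompact.image (by fun_prop)).bddAbove (Set.mem_image_of_mem _ hx)

theorem supportFn_le (hK : IsBody₀ K) (h : ∀ x ∈ K, inner ℝ a x ≤ c) : supportFn K a ≤ c :=
  csSup_le (Set.Nonempty.image _ ⟨0, hK.zero_mem⟩) (by rintro _ ⟨x, hx, rfl⟩; exact h x hx)

theorem supportFn_mono (hK : IsBody₀ K) (hL : IsBody₀ L) (h : K ⊆ L) (a : E n) :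
    supportFn K a ≤ supportFn L a :=
  hK.supportFn_le fun _ hx => hL.inner_le_supportFn (h hx) a

theorem supportFn_pos (hK : IsBody₀ K) (ha : a ∈ Metric.sphere (0 : E n) 1) :
    0 < supportFn K a := by
  obtain ⟨ε, hε, hb⟩ := Metric.nhds_basis_closedBall.mem_iff.1 hK.mem_nhds
  have ha1 : ‖a‖ = 1 := by simpa using ha
  have h := hK.inner_le_supportFn (x := ε • a) (hb (by simp [norm_smul, ha1, abs_of_pos hε])) a
  rw [inner_smul_right, real_inner_self_eq_norm_sq, ha1] at h
  linarith

/-- A body is the intersection of its supporting halfspaces (Hahn–Banach). -/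
theorem mem_of_forall_inner_le (hK : IsBody₀ K)
    (h : ∀ a ∈ Metric.sphere (0 : E n) 1, inner ℝ a x ≤ supportFn K a) : x ∈ K := by
  by_contra hx
  obtain ⟨f, u, hf, hu⟩ :=
    geometric_hahn_banach_closed_point hK.convex hK.isCompact.isClosed hx
  set b : E n := (InnerProductSpace.toDual ℝ (E n)).symm f
  have hb : ∀ y, inner ℝ b y = f y := fun y => InnerProductSpace.toDual_symm_apply
  have hb0 : b ≠ 0 := by
    intro h0
    have h1 := hf 0 hK.zero_mem
    have h2 := hb x
    rw [h0, inner_zero_left] at h2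
    rw [map_zero] at h1
    linarith
  have hn : 0 < ‖b‖ := norm_pos_iff.2 hb0
  have h1 := h (‖b‖⁻¹ • b) (by simp [norm_smul, hn.ne'])
  have h2 : supportFn K (‖b‖⁻¹ • b) ≤ ‖b‖⁻¹ * u := by
    refine hK.supportFn_le fun y hy => ?_
    rw [real_inner_smul_left, hb]
    gcongr
    exact (hf y hy).le
  rw [real_inner_smul_left, hb] at h1
  have h3 := mul_lt_mul_of_pos_left hu (inv_pos.2 hn)
  linarith

theorem gauge_le_one_iff (hK : IsBody₀ K) : gauge K x ≤ 1 ↔ x ∈ K := by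
  rw [gauge_le_one_iff_mem_closure hK.convex hK.mem_nhds, hK.isCompact.isClosed.closure_eq]

theorem gauge_pos (hK : IsBody₀ K) (hx : x ≠ 0) : 0 < gauge K x :=
  (_root_.gauge_pos hK.absorbent
    (NormedSpace.isVonNBounded_of_isBounded ℝ hK.isCompact.isBounded)).2 hx

end IsBody₀

theorem supportFn_smul (K : Set (E n)) (a : E n) (hc : 0 < c) :
    supportFn (c • K) a = c * supportFn K a := by
  rw [supportFn, supportFn, ← smul_eq_mul, ← Real.sSup_smul_of_nonneg hc.le, ← Set.image_smul,
    ← Set.image_smul, Set.image_image, Set.image_image]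
  simp only [inner_smul_right, smul_eq_mul]

theorem supportFn_neg (K : Set (E n)) (a : E n) : supportFn (-K) a = supportFn K (-a) := by
  rw [supportFn, supportFn, ← Set.image_neg_eq_neg, Set.image_image]
  simp only [inner_neg_left, inner_neg_right]

theorem gauge_smul_set (K : Set (E n)) (x : E n) (hc : 0 < c) :
    gauge (c • K) x = c⁻¹ * gauge K x := by
  rw [gauge_smul_left_of_nonneg hc.le, Pi.smul_apply, smul_eq_mul]

theorem gauge_smul_vec (K : Set (E n)) (x : E n) (hc : 0 ≤ c) :
    gauge K (c • x) = c * gauge K x := by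
  rw [gauge_smul_of_nonneg hc, smul_eq_mul]

/-- By Carathéodory's theorem, the convex hull of a compact set is a finite union of continuous
images of compact sets. -/
theorem isCompact_convexHull_of_isCompact {S : Set (E n)} (hS : IsCompact S) :
    IsCompact (convexHull ℝ S) := by
  have h : convexHull ℝ S = ⋃ k ∈ Set.Iic (n + 1),
      (fun q : (Fin k → ℝ) × (Fin k → E n) => ∑ i, q.1 i • q.2 i) ''
        (stdSimplex ℝ (Fin k) ×ˢ Set.univ.pi fun _ => S) := by
    refine Set.Subset.antisymm (fun x hx => ?_) ?_
    · obtain ⟨ι, _, z, w, hz, haff, hw, hw1, rfl⟩ := eq_pos_convex_span_of_mem_convexHull hx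
      refine Set.mem_biUnion (x := Fintype.card ι) ?_ ?_
      · have := haff.card_le_finrank_succ
        have h2 := Submodule.finrank_le (vectorSpan ℝ (Set.range z))
        rw [finrank_euclideanSpace_fin] at h2
        exact this.trans (Nat.succ_le_succ h2)
      · let e := (Fintype.equivFin ι).symm
        refine ⟨(w ∘ e, z ∘ e), ⟨⟨fun i => (hw _).le, ?_⟩, fun i _ => hz ⟨_, rfl⟩⟩, ?_⟩
        · rw [← hw1]
          exact e.sum_comp w
        · exact e.sum_comp fun i => w i • z i
    · refine Set.iUnion₂_subset fun k _ => ?_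
      rintro _ ⟨⟨w, z⟩, ⟨hw, hz⟩, rfl⟩
      exact (convex_convexHull ℝ S).sum_mem (fun i _ => hw.1 i) hw.2
        fun i _ => subset_convexHull ℝ S (hz i trivial)
  rw [h]
  refine (Set.finite_Iic (n + 1)).isCompact_biUnion fun k _ => ?_
  exact ((isCompact_stdSimplex ℝ (Fin k)).prod (isCompact_univ_pi fun _ => hS)).image
    (by fun_prop)

theorem IsBody₀.convexHull_union (hK : IsBody₀ K) (hL : IsBody₀ L) :
    IsBody₀ (convexHull ℝ (K ∪ L)) :=
  .of_mem_nhds (convex_convexHull ℝ _)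
    (isCompact_convexHull_of_isCompact (hK.isCompact.union hL.isCompact))
    (mem_of_superset hK.mem_nhds (Set.subset_union_left.trans (subset_convexHull ℝ _)))

/-! ### Upper means -/

theorem upperMean_comm (p : ℝ) (U V : Set (E n)) : upperMean p U V = upperMean p V U := by
  simp only [upperMean, pMean_comm p (supportFn U _)]

theorem upperMean_neg (p : ℝ) (U V : Set (E n)) :
    upperMean p (-U) (-V) = -upperMean p U V := by
  ext x
  simp only [upperMean, Set.mem_neg, Set.mem_ofPred_eq, supportFn_neg]
  constructor
  · intro h a ha
    simpa using h (-a) (by simpa using ha)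
  · intro h a ha
    simpa using h (-a) (by simpa using ha)

theorem upperMean_mono (p : ℝ) (hU : IsBody₀ U) (hV : IsBody₀ V) (hU₂ : IsBody₀ U₂)
    (hV₂ : IsBody₀ V₂) (h1 : U ⊆ U₂) (h2 : V ⊆ V₂) : upperMean p U V ⊆ upperMean p U₂ V₂ :=
  fun _ hx a ha => (hx a ha).trans <| pMean_mono p (hU.supportFn_pos ha) (hV.supportFn_pos ha)
    (hU.supportFn_mono hU₂ h1 a) (hV.supportFn_mono hV₂ h2 a)

theorem upperMean_smul (p : ℝ) (hU : IsBody₀ U) (hV : IsBody₀ V) (hc : 0 < c) :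
    upperMean p (c • U) (c • V) = c • upperMean p U V := by
  ext x
  rw [Set.mem_smul_set_iff_inv_smul_mem₀ hc.ne']
  refine forall₂_congr fun a ha => ?_
  rw [supportFn_smul _ _ hc, supportFn_smul _ _ hc,
    pMean_mul p hc (hU.supportFn_pos ha).le (hV.supportFn_pos ha).le, inner_smul_right,
    inv_mul_le_iff₀ hc]

theorem upperMean_smul_self (p : ℝ) (hK : IsBody₀ K) (hb : 0 < b) (hc : 0 < c) :
    upperMean p (b • K) (c • K) = pMean p b c • K := by
  have hm := pMean_pos p hb hc
  have key : ∀ a ∈ Metric.sphere (0 : E n) 1,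
      pMean p (supportFn (b • K) a) (supportFn (c • K) a) = supportFn (pMean p b c • K) a := by
    intro a ha
    rw [supportFn_smul _ _ hb, supportFn_smul _ _ hc, supportFn_smul _ _ hm, mul_comm b,
      mul_comm c, pMean_mul p (hK.supportFn_pos ha) hb.le hc.le, mul_comm]
  refine Set.Subset.antisymm (fun x hx => ?_) fun x hx a ha => ?_
  · exact (hK.smul hm).mem_of_forall_inner_le fun a ha => (hx a ha).trans_eq (key a ha)
  · rw [key a ha]
    exact (hK.smul hm).inner_le_supportFn hx a

theorem upperMean_self (p : ℝ) (hK : IsBody₀ K) : upperMean p K K = K := by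
  simpa [pMean_self p one_pos] using upperMean_smul_self p hK one_pos one_pos

theorem convex_upperMean (p : ℝ) (U V : Set (E n)) : Convex ℝ (upperMean p U V) := by
  have h : upperMean p U V = ⋂ a ∈ Metric.sphere (0 : E n) 1,
      {x | innerₗ (E n) a x ≤ pMean p (supportFn U a) (supportFn V a)} := by
    ext x
    simp [upperMean]
  rw [h]
  exact convex_iInter₂ fun a _ => convex_halfSpace_le (innerₗ (E n) a).isLinear _

theorem isClosed_upperMean (p : ℝ) (U V : Set (E n)) : IsClosed (upperMean p U V) := by
  have h : upperMean p U V = ⋂ a ∈ Metric.sphere (0 : E n) 1,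
      {x | inner ℝ a x ≤ pMean p (supportFn U a) (supportFn V a)} := by
    ext x
    simp [upperMean]
  rw [h]
  exact isClosed_biInter fun a _ => isClosed_le (by fun_prop) continuous_const

theorem inter_subset_upperMean (p : ℝ) (hU : IsBody₀ U) (hV : IsBody₀ V) :
    U ∩ V ⊆ upperMean p U V := by
  have hI := hU.inter hV
  conv_lhs => rw [← upperMean_self p hI]
  exact upperMean_mono p hI hI hU hV Set.inter_subset_left Set.inter_subset_right

theorem upperMean_subset_convexHull_union (p : ℝ) (hU : IsBody₀ U) (hV : IsBody₀ V) :
    upperMean p U V ⊆ convexHull ℝ (U ∪ V) := by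
  have hC := hU.convexHull_union hV
  conv_rhs => rw [← upperMean_self p hC]
  exact upperMean_mono p hU hV hC hC (Set.subset_union_left.trans (subset_convexHull ℝ _))
    (Set.subset_union_right.trans (subset_convexHull ℝ _))

theorem IsBody₀.upperMean (p : ℝ) (hU : IsBody₀ U) (hV : IsBody₀ V) :
    IsBody₀ (upperMean p U V) :=
  .of_mem_nhds (convex_upperMean p U V)
    ((hU.convexHull_union hV).isCompact.of_isClosed_subset (isClosed_upperMean p U V)
      (upperMean_subset_convexHull_union p hU hV))
    (mem_of_superset (hU.inter hV).mem_nhds (inter_subset_upperMean p hU hV))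

/-! ### Lower means -/

theorem lowerMean_comm (p : ℝ) (U V : Set (E n)) : lowerMean p U V = lowerMean p V U := by
  simp only [lowerMean, pMean_comm (-p) (gauge U _)]

theorem convex_lowerMean (p : ℝ) (U V : Set (E n)) : Convex ℝ (lowerMean p U V) :=
  convex_convexHull ℝ _

theorem lowerMean_neg_subset (p : ℝ) (U V : Set (E n)) :
    lowerMean p (-U) (-V) ⊆ -lowerMean p U V := by
  refine convexHull_min ?_ (convex_lowerMean p U V).neg
  rintro _ ⟨x, hx, rfl⟩
  refine subset_convexHull ℝ _ ⟨-x, by simpa using hx, ?_⟩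
  simp [gauge_neg_set_eq_gauge_neg]

theorem lowerMean_neg (p : ℝ) (U V : Set (E n)) :
    lowerMean p (-U) (-V) = -lowerMean p U V := by
  refine Set.Subset.antisymm (lowerMean_neg_subset p U V) ?_
  have h := lowerMean_neg_subset p (-U) (-V)
  rw [neg_neg, neg_neg] at h
  exact Set.neg_subset.2 h

theorem lowerMean_smul (p : ℝ) (U V : Set (E n)) (hc : 0 < c) :
    lowerMean p (c • U) (c • V) = c • lowerMean p U V := by
  rw [lowerMean, lowerMean, ← convexHull_smul]
  congr 1
  refine (Set.image_congr fun x _ => ?_).trans (Set.image_image (c • ·) _ _).symm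
  rw [gauge_smul_set _ _ hc, gauge_smul_set _ _ hc,
    pMean_mul _ (inv_pos.2 hc) (gauge_nonneg x) (gauge_nonneg x), mul_inv, inv_inv, mul_smul]

/-- The points spanning a lower mean are those at which the mean of the gauges equals `1`. -/
theorem lowerMean_subset (p : ℝ) (hU : IsBody₀ U) (hV : IsBody₀ V) {S : Set (E n)}
    (hS : Convex ℝ S)
    (h : ∀ y, y ≠ 0 → pMean (-p) (gauge U y) (gauge V y) = 1 → y ∈ S) :
    lowerMean p U V ⊆ S := by
  refine convexHull_min ?_ hS
  rintro _ ⟨x, hx, rfl⟩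
  have hx0 : x ≠ 0 := ne_zero_of_mem_unit_sphere ⟨x, hx⟩
  have hm := pMean_pos (-p) (hU.gauge_pos hx0) (hV.gauge_pos hx0)
  refine h _ (smul_ne_zero (inv_pos.2 hm).ne' hx0) ?_
  rw [gauge_smul_vec _ _ (inv_pos.2 hm).le, gauge_smul_vec _ _ (inv_pos.2 hm).le,
    pMean_mul _ (inv_pos.2 hm) (gauge_nonneg x) (gauge_nonneg x), inv_mul_cancel₀ hm.ne']

theorem mem_lowerMean_of_eq_one (p : ℝ)
    (hx : x ≠ 0) (h : pMean (-p) (gauge U x) (gauge V x) = 1) : x ∈ lowerMean p U V := by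
  have hn : 0 < ‖x‖ := norm_pos_iff.2 hx
  refine subset_convexHull ℝ _ ⟨‖x‖⁻¹ • x, by simp [norm_smul, hn.ne'], ?_⟩
  simp only
  rw [gauge_smul_vec _ _ (inv_pos.2 hn).le, gauge_smul_vec _ _ (inv_pos.2 hn).le,
    pMean_mul _ (inv_pos.2 hn) (gauge_nonneg x) (gauge_nonneg x), h, mul_one, inv_inv,
    smul_inv_smul₀ hn.ne']

/-- In positive dimension a lower mean contains two points on opposite rays, hence the origin. -/
theorem zero_mem_lowerMean (hn : 1 ≤ n) (p : ℝ) (hU : IsBody₀ U) (hV : IsBody₀ V) :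
    (0 : E n) ∈ lowerMean p U V := by
  have : Nonempty (Fin n) := ⟨⟨0, hn⟩⟩
  obtain ⟨u, hu⟩ := (NormedSpace.sphere_nonempty (E := E n) (x := 0) (r := 1)).2 zero_le_one
  have hu0 : u ≠ 0 := ne_zero_of_mem_unit_sphere ⟨u, hu⟩
  have h1 := pMean_pos (-p) (hU.gauge_pos hu0) (hV.gauge_pos hu0)
  have h2 := pMean_pos (-p) (hU.gauge_pos (neg_ne_zero.2 hu0)) (hV.gauge_pos (neg_ne_zero.2 hu0))
  have hy : (pMean (-p) (gauge U u) (gauge V u))⁻¹ • u ∈ lowerMean p U V :=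
    subset_convexHull ℝ _ ⟨u, hu, rfl⟩
  have hz : (pMean (-p) (gauge U (-u)) (gauge V (-u)))⁻¹ • -u ∈ lowerMean p U V :=
    subset_convexHull ℝ _ ⟨-u, by simpa using hu, rfl⟩
  set α := pMean (-p) (gauge U u) (gauge V u)
  set β := pMean (-p) (gauge U (-u)) (gauge V (-u))
  have h := convex_lowerMean p U V hy hz (a := α / (α + β)) (b := β / (α + β)) (by positivity)
    (by positivity) (by field_simp)
  convert h using 1
  rw [smul_smul, smul_smul, smul_neg, ← sub_eq_add_neg, ← sub_smul]
  have : α / (α + β) * α⁻¹ - β / (α + β) * β⁻¹ = 0 := by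
    field_simp
    simp
  rw [this, zero_smul]

theorem mem_lowerMean (hn : 1 ≤ n) (p : ℝ) (hU : IsBody₀ U) (hV : IsBody₀ V)
    (hx : x ≠ 0) (h : pMean (-p) (gauge U x) (gauge V x) ≤ 1) : x ∈ lowerMean p U V := by
  have hm := pMean_pos (-p) (hU.gauge_pos hx) (hV.gauge_pos hx)
  set m := pMean (-p) (gauge U x) (gauge V x) with hmdef
  have hy : m⁻¹ • x ∈ lowerMean p U V := by
    refine mem_lowerMean_of_eq_one p (smul_ne_zero (inv_pos.2 hm).ne' hx) ?_
    rw [gauge_smul_vec _ _ (inv_pos.2 hm).le, gauge_smul_vec _ _ (inv_pos.2 hm).le,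
      pMean_mul _ (inv_pos.2 hm) (gauge_nonneg x) (gauge_nonneg x), ← hmdef,
      inv_mul_cancel₀ hm.ne']
  have := (convex_lowerMean p U V).smul_mem_of_zero_mem (zero_mem_lowerMean hn p hU hV) hy
    ⟨hm.le, h⟩
  rwa [smul_inv_smul₀ hm.ne'] at this

theorem lowerMean_mono (hn : 1 ≤ n) (p : ℝ) (hU : IsBody₀ U) (hV : IsBody₀ V)
    (hU₂ : IsBody₀ U₂) (hV₂ : IsBody₀ V₂) (h1 : U ⊆ U₂) (h2 : V ⊆ V₂) :
    lowerMean p U V ⊆ lowerMean p U₂ V₂ :=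
  lowerMean_subset p hU hV (convex_lowerMean p _ _) fun y hy hy1 =>
    mem_lowerMean hn p hU₂ hV₂ hy <| hy1 ▸ pMean_mono (-p) (hU₂.gauge_pos hy) (hV₂.gauge_pos hy)
      (gauge_mono hU.absorbent h1 y) (gauge_mono hV.absorbent h2 y)

theorem lowerMean_smul_self (hn : 1 ≤ n) (p : ℝ) (hK : IsBody₀ K) (hb : 0 < b) (hc : 0 < c) :
    lowerMean p (b • K) (c • K) = (pMean (-p) b⁻¹ c⁻¹)⁻¹ • K := by
  have hm := pMean_pos (-p) (inv_pos.2 hb) (inv_pos.2 hc)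
  have key : ∀ y, y ≠ 0 → pMean (-p) (gauge (b • K) y) (gauge (c • K) y) =
      gauge ((pMean (-p) b⁻¹ c⁻¹)⁻¹ • K) y := by
    intro y hy
    rw [gauge_smul_set _ _ hb, gauge_smul_set _ _ hc, gauge_smul_set _ _ (inv_pos.2 hm), inv_inv,
      mul_comm b⁻¹, mul_comm c⁻¹,
      pMean_mul _ (hK.gauge_pos hy) (inv_pos.2 hb).le (inv_pos.2 hc).le, mul_comm]
  have hmK := hK.smul (inv_pos.2 hm)
  refine Set.Subset.antisymm ?_ fun x hx => ?_
  · refine lowerMean_subset p (hK.smul hb) (hK.smul hc) hmK.convex fun y hy hy1 => ?_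
    rw [← hmK.gauge_le_one_iff, ← key y hy, hy1]
  · rcases eq_or_ne x 0 with rfl | hx0
    · exact zero_mem_lowerMean hn p (hK.smul hb) (hK.smul hc)
    · refine mem_lowerMean hn p (hK.smul hb) (hK.smul hc) hx0 ?_
      rw [key x hx0]
      exact hmK.gauge_le_one_iff.2 hx

theorem lowerMean_self (hn : 1 ≤ n) (p : ℝ) (hK : IsBody₀ K) : lowerMean p K K = K := by
  simpa [pMean_self _ one_pos] using lowerMean_smul_self hn p hK one_pos one_pos

theorem inter_subset_lowerMean (hn : 1 ≤ n) (p : ℝ) (hU : IsBody₀ U) (hV : IsBody₀ V) :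
    U ∩ V ⊆ lowerMean p U V := by
  have hI := hU.inter hV
  conv_lhs => rw [← lowerMean_self hn p hI]
  exact lowerMean_mono hn p hI hI hU hV Set.inter_subset_left Set.inter_subset_right

theorem lowerMean_subset_convexHull_union (hn : 1 ≤ n) (p : ℝ) (hU : IsBody₀ U)
    (hV : IsBody₀ V) : lowerMean p U V ⊆ convexHull ℝ (U ∪ V) := by
  have hC := hU.convexHull_union hV
  conv_rhs => rw [← lowerMean_self hn p hC]
  exact lowerMean_mono hn p hU hV hC hC (Set.subset_union_left.trans (subset_convexHull ℝ _))
    (Set.subset_union_right.trans (subset_convexHull ℝ _))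

theorem isCompact_lowerMean (p : ℝ) (hU : IsBody₀ U) (hV : IsBody₀ V) :
    IsCompact (lowerMean p U V) := by
  refine isCompact_convexHull_of_isCompact ((isCompact_sphere _ _).image_of_continuousOn ?_)
  have hpos : ∀ x ∈ Metric.sphere (0 : E n) 1, 0 < gauge U x ∧ 0 < gauge V x := fun x hx =>
    have hx0 : x ≠ 0 := ne_zero_of_mem_unit_sphere ⟨x, hx⟩
    ⟨hU.gauge_pos hx0, hV.gauge_pos hx0⟩
  refine ContinuousOn.smul (ContinuousOn.inv₀ ?_ fun x hx =>
    (pMean_pos (-p) (hpos x hx).1 (hpos x hx).2).ne') continuousOn_id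
  have hg : Continuous fun x => (gauge U x, gauge V x) :=
    (continuous_gauge hU.convex hU.mem_nhds).prodMk (continuous_gauge hV.convex hV.mem_nhds)
  exact ContinuousOn.comp (f := fun x => (gauge U x, gauge V x)) (continuousOn_pMean (-p))
    hg.continuousOn hpos

theorem IsBody₀.lowerMean (hn : 1 ≤ n) (p : ℝ) (hU : IsBody₀ U) (hV : IsBody₀ V) :
    IsBody₀ (lowerMean p U V) :=
  .of_mem_nhds (convex_lowerMean p U V) (isCompact_lowerMean p hU hV)
    (mem_of_superset (hU.inter hV).mem_nhds (inter_subset_lowerMean hn p hU hV))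

/-! ### Scaling of bodies -/

theorem IsBody₀.smul_subset_smul (hK : IsBody₀ K) (hb : 0 < b) (h : b ≤ c) : b • K ⊆ c • K := by
  intro x hx
  rw [← (hK.smul hb).gauge_le_one_iff, gauge_smul_set _ _ hb] at hx
  rw [← (hK.smul (hb.trans_le h)).gauge_le_one_iff, gauge_smul_set _ _ (hb.trans_le h)]
  exact (mul_le_mul_of_nonneg_right (inv_anti₀ hb h) (gauge_nonneg x)).trans hx

theorem IsBody₀.subset_smul (hK : IsBody₀ K) (h : 1 ≤ c) : K ⊆ c • K := by
  simpa using hK.smul_subset_smul one_pos h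

theorem IsBody₀.exists_subset_smul (hK : IsBody₀ K) (hL : IsBody₀ L) :
    ∃ r : ℝ, 1 ≤ r ∧ K ⊆ r • L ∧ L ⊆ r • K := by
  have key : ∀ {A B : Set (E n)}, IsBody₀ A → IsBody₀ B → ∃ r : ℝ, 0 < r ∧ A ⊆ r • B := by
    intro A B hA hB
    obtain ⟨r, hr, h⟩ :=
      (NormedSpace.isVonNBounded_of_isBounded ℝ hA.isCompact.isBounded hB.mem_nhds).exists_pos
    exact ⟨r, hr, h r (le_abs_self r)⟩
  obtain ⟨r, hr, h1⟩ := key hK hL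
  obtain ⟨t, ht, h2⟩ := key hL hK
  exact ⟨max 1 (max r t), le_max_left _ _,
    h1.trans (hL.smul_subset_smul hr ((le_max_left _ _).trans (le_max_right _ _))),
    h2.trans (hK.smul_subset_smul ht ((le_max_right _ _).trans (le_max_right _ _)))⟩

/-! ### Convergence of the iterated means -/

/-- The contraction estimate: one step replaces the ratio `r` by `ratioStep p r`. Comparing `V`
with `U` bounds both means by multiples of `U`, and comparing `U` with `V` by the same multiples
of `V`. -/
theorem means_subset_smul_inter (hn : 1 ≤ n) (p : ℝ) (hU : IsBody₀ U) (hV : IsBody₀ V)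
    (hr : 0 < r) (h1 : U ⊆ r • V) (h2 : V ⊆ r • U) :
    upperMean p U V ⊆ ratioStep p r • (U ∩ V) ∧
      lowerMean (-p) U V ⊆ ratioStep p r • (U ∩ V) := by
  have hm := pMean_pos p one_pos hr
  have hI := hU.inter hV
  have ha : ∀ {A B : Set (E n)}, IsBody₀ A → IsBody₀ B → B ⊆ r • A →
      upperMean p A B ⊆ pMean p 1 r • A ∧ lowerMean (-p) A B ⊆ (r / pMean p 1 r) • A := by
    intro A B hA hB h
    refine ⟨?_, ?_⟩
    · rw [← upperMean_smul_self p hA one_pos hr, one_smul]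
      exact upperMean_mono p hA hB hA (hA.smul hr) subset_rfl h
    · have hd : r / pMean p 1 r = (pMean (- -p) 1⁻¹ r⁻¹)⁻¹ := by
        rw [neg_neg, inv_one, pMean_one_inv p hr, mul_inv, inv_inv, div_eq_mul_inv]
      rw [hd, ← lowerMean_smul_self hn (-p) hA one_pos hr, one_smul]
      exact lowerMean_mono hn (-p) hA hB hA (hA.smul hr) subset_rfl h
  obtain ⟨u1, l1⟩ := ha hU hV h2
  obtain ⟨u2, l2⟩ := ha hV hU h1
  rw [upperMean_comm] at u2
  rw [lowerMean_comm] at l2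
  refine ⟨?_, ?_⟩
  · refine (Set.subset_inter u1 u2).trans ?_
    rw [← Set.smul_set_inter₀ hm.ne']
    exact hI.smul_subset_smul hm (le_max_left _ _)
  · refine (Set.subset_inter l1 l2).trans ?_
    rw [← Set.smul_set_inter₀ (div_pos hr hm).ne']
    exact hI.smul_subset_smul (div_pos hr hm) (le_max_right _ _)

theorem isBody₀_iterMeans (hn : 1 ≤ n) (p : ℝ) (hK : IsBody₀ K) (hL : IsBody₀ L) (i : ℕ) :
    IsBody₀ (iterMeans p K L i).1 ∧ IsBody₀ (iterMeans p K L i).2 := by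
  induction i with
  | zero => exact ⟨hK, hL⟩
  | succ i ih => exact ⟨ih.1.upperMean p ih.2, ih.1.lowerMean hn (-p) ih.2⟩

theorem iterMeans_subset_smul (hn : 1 ≤ n) (p : ℝ) (hK : IsBody₀ K) (hL : IsBody₀ L)
    (hr : 1 ≤ r) (h1 : K ⊆ r • L) (h2 : L ⊆ r • K) (i : ℕ) :
    (iterMeans p K L i).1 ⊆ (ratioStep p)^[i] r • (iterMeans p K L i).2 ∧
      (iterMeans p K L i).2 ⊆ (ratioStep p)^[i] r • (iterMeans p K L i).1 := by
  induction i with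
  | zero => exact ⟨h1, h2⟩
  | succ i ih =>
    obtain ⟨hU, hV⟩ := isBody₀_iterMeans hn p hK hL i
    rw [Function.iterate_succ_apply']
    have h := means_subset_smul_inter hn p hU hV
      (one_pos.trans_le (one_le_iterate_ratioStep p hr i)) ih.1 ih.2
    exact ⟨h.1.trans (Set.smul_set_mono (inter_subset_lowerMean hn (-p) hU hV)),
      h.2.trans (Set.smul_set_mono (inter_subset_upperMean p hU hV))⟩

theorem iterMeans_inter_mono (hn : 1 ≤ n) (p : ℝ) (hK : IsBody₀ K) (hL : IsBody₀ L) :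
    Monotone fun i => (iterMeans p K L i).1 ∩ (iterMeans p K L i).2 := by
  refine monotone_nat_of_le_succ fun i => ?_
  obtain ⟨hU, hV⟩ := isBody₀_iterMeans hn p hK hL i
  exact Set.subset_inter (inter_subset_upperMean p hU hV) (inter_subset_lowerMean hn (-p) hU hV)

theorem iterMeans_convexHull_union_anti (hn : 1 ≤ n) (p : ℝ) (hK : IsBody₀ K)
    (hL : IsBody₀ L) :
    Antitone fun i => convexHull ℝ ((iterMeans p K L i).1 ∪ (iterMeans p K L i).2) := by
  refine antitone_nat_of_succ_le fun i => ?_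
  obtain ⟨hU, hV⟩ := isBody₀_iterMeans hn p hK hL i
  exact convexHull_min (Set.union_subset (upperMean_subset_convexHull_union p hU hV)
    (lowerMean_subset_convexHull_union hn (-p) hU hV)) (convex_convexHull ℝ _)

/-- Convergence of sets in the multiplicative sense: the sets `X i` and `G` contain each other up
to factors `r i ≥ 1` that tend to `1`. For bodies this is Hausdorff convergence. -/
structure IsRatioLimit (r : ℕ → ℝ) (X : ℕ → Set (E n)) (G : Set (E n)) : Prop where
  tendsto : Tendsto r atTop (𝓝 1)
  one_le : ∀ i, 1 ≤ r i
  subset : ∀ i, X i ⊆ r i • G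
  superset : ∀ i, G ⊆ r i • X i

/-- The limit is the intersection of the decreasing bodies `conv (Uᵢ ∪ Vᵢ)`. It contains the
increasing bodies `Uᵢ ∩ Vᵢ`, and the two sequences differ by a factor that tends to `1`. -/
theorem exists_isRatioLimit_iterMeans (hn : 1 ≤ n) (p : ℝ) (hK : IsBody₀ K) (hL : IsBody₀ L) :
    ∃ G : Set (E n), IsBody₀ G ∧ ∃ r : ℕ → ℝ,
      IsRatioLimit r (fun i => (iterMeans p K L i).1) G ∧
      IsRatioLimit r (fun i => (iterMeans p K L i).2) G := by
  obtain ⟨t, ht, h1, h2⟩ := hK.exists_subset_smul hL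
  let r : ℕ → ℝ := fun i => (ratioStep p)^[i] t
  have hr1 : ∀ i, 1 ≤ r i := one_le_iterate_ratioStep p ht
  have hr : Tendsto r atTop (𝓝 1) := tendsto_iterate_ratioStep p ht
  have hb := isBody₀_iterMeans hn p hK hL
  have hs := iterMeans_subset_smul hn p hK hL ht h1 h2
  have hmono := iterMeans_inter_mono hn p hK hL
  have hanti := iterMeans_convexHull_union_anti hn p hK hL
  let C : ℕ → Set (E n) := fun i => convexHull ℝ ((iterMeans p K L i).1 ∪ (iterMeans p K L i).2)
  have hUC : ∀ i, (iterMeans p K L i).1 ⊆ C i := fun i =>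
    Set.subset_union_left.trans (subset_convexHull ℝ _)
  have hVC : ∀ i, (iterMeans p K L i).2 ⊆ C i := fun i =>
    Set.subset_union_right.trans (subset_convexHull ℝ _)
  have hC : ∀ i, IsBody₀ (C i) := fun i => (hb i).1.convexHull_union (hb i).2
  have hIG : ∀ i, (iterMeans p K L i).1 ∩ (iterMeans p K L i).2 ⊆ ⋂ j, C j := fun i =>
    Set.subset_iInter fun j => (hmono (le_max_left i j)).trans
      (Set.inter_subset_left.trans ((hUC _).trans (hanti (le_max_right i j))))
  have hCI : ∀ i, C i ⊆ r i • ((iterMeans p K L i).1 ∩ (iterMeans p K L i).2) := by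
    intro i
    have h0 : r i ≠ 0 := (one_pos.trans_le (hr1 i)).ne'
    refine convexHull_min ?_ (((hb i).1.convex.inter (hb i).2.convex).smul _)
    rw [Set.smul_set_inter₀ h0]
    exact Set.union_subset (Set.subset_inter ((hb i).1.subset_smul (hr1 i)) (hs i).1)
      (Set.subset_inter (hs i).2 ((hb i).2.subset_smul (hr1 i)))
  refine ⟨⋂ j, C j, .of_mem_nhds (convex_iInter fun j => (hC j).convex) ?_ ?_, r, ?_, ?_⟩
  · exact (hC 0).isCompact.of_isClosed_subset (isClosed_iInter fun j => (hC j).isCompact.isClosed)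
      (Set.iInter_subset C 0)
  · exact mem_of_superset ((hb 0).1.inter (hb 0).2).mem_nhds (hIG 0)
  · exact ⟨hr, hr1, fun i => (hUC i).trans ((hCI i).trans (Set.smul_set_mono (hIG i))),
      fun i => (Set.iInter_subset C i).trans
        ((hCI i).trans (Set.smul_set_mono Set.inter_subset_left))⟩
  · exact ⟨hr, hr1, fun i => (hVC i).trans ((hCI i).trans (Set.smul_set_mono (hIG i))),
      fun i => (Set.iInter_subset C i).trans
        ((hCI i).trans (Set.smul_set_mono Set.inter_subset_right))⟩

theorem IsRatioLimit.tendsto_hausdorffEDist {r : ℕ → ℝ} {X : ℕ → Set (E n)}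
    (h : IsRatioLimit r X G) (hG : IsBody₀ G) :
    Tendsto (fun i => Metric.hausdorffEDist (X i) G) atTop (𝓝 0) := by
  obtain ⟨R, hR0, hR⟩ := hG.isCompact.isBounded.exists_pos_norm_le
  have hlim : Tendsto (fun i => ENNReal.ofReal ((r i - 1) * (r i * R))) atTop (𝓝 0) := by
    have h1 : Tendsto (fun i => (r i - 1) * (r i * R)) atTop (𝓝 ((1 - 1) * (1 * R))) :=
      (h.tendsto.sub_const 1).mul (h.tendsto.mul_const R)
    simpa using ENNReal.tendsto_ofReal h1
  have hdist : ∀ i (y : E n), ‖y‖ ≤ r i * R →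
      edist (r i • y) y ≤ ENNReal.ofReal ((r i - 1) * (r i * R)) := by
    intro i y hy
    have h1 : r i • y - y = (r i - 1) • y := by rw [sub_smul, one_smul]
    rw [edist_dist, dist_eq_norm, h1, norm_smul, Real.norm_of_nonneg (sub_nonneg.2 (h.one_le i))]
    exact ENNReal.ofReal_le_ofReal
      (mul_le_mul_of_nonneg_left hy (sub_nonneg.2 (h.one_le i)))
  have hr0 : ∀ i, 0 < r i := fun i => one_pos.trans_le (h.one_le i)
  refine tendsto_of_tendsto_of_tendsto_of_le_of_le tendsto_const_nhds hlim
    (fun _ => zero_le) fun i => Metric.hausdorffEDist_le_of_mem_edist ?_ ?_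
  · intro x hx
    obtain ⟨g, hg, rfl⟩ := h.subset i hx
    exact ⟨g, hg, hdist i g ((hR g hg).trans (le_mul_of_one_le_left hR0.le (h.one_le i)))⟩
  · intro g hg
    obtain ⟨x, hx, rfl⟩ := h.superset i hg
    refine ⟨x, hx, hdist i x ?_⟩
    obtain ⟨g', hg', rfl⟩ := h.subset i hx
    simp only [norm_smul, Real.norm_of_nonneg (hr0 i).le]
    exact mul_le_mul_of_nonneg_left (hR g' hg') (hr0 i).le

theorem IsCommonLimit.unique {G' : Set (E n)} (h : IsCommonLimit p K L G)
    (h' : IsCommonLimit p K L G') : G = G' := by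
  refine (h.isBody₀.isCompact.isClosed.hausdorffEDist_zero_iff
    h'.isBody₀.isCompact.isClosed).1 ?_
  have hlim := h.tendsto_upper.add h'.tendsto_upper
  rw [add_zero] at hlim
  refine le_antisymm (ge_of_tendsto' hlim fun i => ?_) zero_le
  rw [Metric.hausdorffEDist_comm (s := (iterMeans p K L i).1) (t := G)]
  exact Metric.hausdorffEDist_triangle

theorem geomMean_spec (hn : 1 ≤ n) (p : ℝ) (hK : IsBody₀ K) (hL : IsBody₀ L) :
    IsCommonLimit p K L (geomMean p K L) ∧ ∃ r : ℕ → ℝ,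
      IsRatioLimit r (fun i => (iterMeans p K L i).1) (geomMean p K L) ∧
      IsRatioLimit r (fun i => (iterMeans p K L i).2) (geomMean p K L) := by
  obtain ⟨G, hG, r, hU, hV⟩ := exists_isRatioLimit_iterMeans hn p hK hL
  have hlim : IsCommonLimit p K L G :=
    ⟨hG, hU.tendsto_hausdorffEDist hG, hV.tendsto_hausdorffEDist hG⟩
  have hex : ∃ G : Set (E n), IsCommonLimit p K L G := ⟨G, hlim⟩
  have hg : geomMean p K L = G := by
    rw [geomMean, dif_pos hex]
    exact hex.choose_spec.unique hlim
  rw [hg]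
  exact ⟨hlim, r, hU, hV⟩

/-! ### Inclusions that pass to the limit -/

theorem IsBody₀.subset_of_eventually_subset_smul {A : Set (E n)} (hG : IsBody₀ G) {r : ℕ → ℝ}
    (hr : Tendsto r atTop (𝓝 1)) (h : ∀ᶠ i in atTop, A ⊆ r i • G) : A ⊆ G := by
  intro x hx
  refine hG.gauge_le_one_iff.1 (ge_of_tendsto hr ?_)
  filter_upwards [h, hr.eventually (lt_mem_nhds one_pos)] with i hi h0
  exact gauge_le_of_mem h0.le (hi hx)

theorem IsRatioLimit.subset_smul_neg {r : ℕ → ℝ} {X : ℕ → Set (E n)} (h : IsRatioLimit r X G)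
    (hG : IsBody₀ G) (hs : 0 < s) (hX : ∀ᶠ i in atTop, X i ⊆ s • -X i) : G ⊆ s • -G := by
  have hr : Tendsto (fun i => r i * r i) atTop (𝓝 1) := by
    simpa using h.tendsto.mul h.tendsto
  refine (hG.neg.smul hs).subset_of_eventually_subset_smul hr ?_
  filter_upwards [hX] with i hi
  have h1 : -X i ⊆ r i • -G := by
    rw [Set.smul_set_neg]
    exact Set.neg_subset_neg.2 (h.subset i)
  calc G ⊆ r i • X i := h.superset i
    _ ⊆ r i • s • r i • -G := Set.smul_set_mono (hi.trans (Set.smul_set_mono h1))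
    _ = (r i * r i) • s • -G := by rw [smul_comm s, smul_smul (r i)]

theorem isZeroSymmetric_of_subset (h : K ⊆ -K) : IsZeroSymmetric K :=
  h.antisymm (Set.neg_subset.2 h)

theorem IsRatioLimit.isZeroSymmetric {r : ℕ → ℝ} {X : ℕ → Set (E n)} (h : IsRatioLimit r X G)
    (hG : IsBody₀ G) (hX : ∀ᶠ i in atTop, IsZeroSymmetric (X i)) : IsZeroSymmetric G := by
  refine isZeroSymmetric_of_subset ?_
  have := h.subset_smul_neg hG one_pos (hX.mono fun i hi => by rw [one_smul]; exact hi.subset)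
  rwa [one_smul] at this

/-! ### Symmetry and asymmetry of the iterated means -/

theorem IsZeroSymmetric.upperMean (p : ℝ) (hU : IsZeroSymmetric U) (hV : IsZeroSymmetric V) :
    IsZeroSymmetric (upperMean p U V) := by
  rw [IsZeroSymmetric, ← upperMean_neg, ← hU, ← hV]

theorem IsZeroSymmetric.lowerMean (p : ℝ) (hU : IsZeroSymmetric U) (hV : IsZeroSymmetric V) :
    IsZeroSymmetric (lowerMean p U V) := by
  rw [IsZeroSymmetric, ← lowerMean_neg, ← hU, ← hV]

theorem isZeroSymmetric_iterMeans_neg (p : ℝ) (K : Set (E n)) (i : ℕ) :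
    IsZeroSymmetric (iterMeans p K (-K) (i + 1)).1 ∧
      IsZeroSymmetric (iterMeans p K (-K) (i + 1)).2 := by
  induction i with
  | zero =>
    refine ⟨?_, ?_⟩
    · change upperMean p K (-K) = -upperMean p K (-K)
      rw [← upperMean_neg, neg_neg, upperMean_comm]
    · change lowerMean (-p) K (-K) = -lowerMean (-p) K (-K)
      rw [← lowerMean_neg, neg_neg, lowerMean_comm]
  | succ i ih => exact ⟨ih.1.upperMean p ih.2, ih.1.lowerMean (-p) ih.2⟩

theorem isZeroSymmetric_iterMeans (p : ℝ) (hK : IsZeroSymmetric K) (hL : IsZeroSymmetric L)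
    (i : ℕ) :
    IsZeroSymmetric (iterMeans p K L i).1 ∧ IsZeroSymmetric (iterMeans p K L i).2 := by
  induction i with
  | zero => exact ⟨hK, hL⟩
  | succ i ih => exact ⟨ih.1.upperMean p ih.2, ih.1.lowerMean (-p) ih.2⟩

theorem iterMeans_subset_smul_neg (hn : 1 ≤ n) (p : ℝ) (hK : IsBody₀ K) (hL : IsBody₀ L)
    (hs : 0 < s) (h1 : K ⊆ s • -K) (h2 : L ⊆ s • -L) (i : ℕ) :
    (iterMeans p K L i).1 ⊆ s • -(iterMeans p K L i).1 ∧
      (iterMeans p K L i).2 ⊆ s • -(iterMeans p K L i).2 := by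
  induction i with
  | zero => exact ⟨h1, h2⟩
  | succ i ih =>
    obtain ⟨hU, hV⟩ := isBody₀_iterMeans hn p hK hL i
    refine ⟨?_, ?_⟩
    · have h := upperMean_mono p hU hV (hU.neg.smul hs) (hV.neg.smul hs) ih.1 ih.2
      rwa [upperMean_smul p hU.neg hV.neg hs, upperMean_neg] at h
    · have h := lowerMean_mono hn (-p) hU hV (hU.neg.smul hs) (hV.neg.smul hs) ih.1 ih.2
      rwa [lowerMean_smul _ _ _ hs, lowerMean_neg] at h

theorem isMinkowskiCentered_iff : IsMinkowskiCentered K ↔ K ⊆ asymmetry K • -K := by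
  rw [IsMinkowskiCentered, Set.neg_smul_set, Set.smul_set_neg]

theorem asymmetry_le_of_subset {t : E n} (hr : 0 ≤ r) (h : K ⊆ r • -K + {t}) :
    asymmetry K ≤ r :=
  csInf_le ⟨0, fun _ hr => hr.1⟩ ⟨hr, t, h⟩

theorem asymmetry_pos (hn : 1 ≤ n) (hK : IsBody₀ K) (h : IsMinkowskiCentered K) :
    0 < asymmetry K := by
  refine lt_of_le_of_ne (Real.sInf_nonneg fun _ hr => hr.1) fun h0 => ?_
  have : Nonempty (Fin n) := ⟨⟨0, hn⟩⟩
  obtain ⟨u, hu⟩ := (NormedSpace.sphere_nonempty (E := E n) (x := 0) (r := 1)).2 zero_le_one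
  have hu0 : u ≠ 0 := ne_zero_of_mem_unit_sphere ⟨u, hu⟩
  have hg := hK.gauge_pos hu0
  have hmem : (gauge K u)⁻¹ • u ∈ K := by
    rw [← hK.gauge_le_one_iff, gauge_smul_vec _ _ (inv_pos.2 hg).le, inv_mul_cancel₀ hg.ne']
  have := h hmem
  rw [← h0, neg_zero] at this
  obtain ⟨y, -, hy⟩ := this
  simp only [zero_smul] at hy
  exact smul_ne_zero (inv_pos.2 hg).ne' hu0 hy.symm

/-! ### The Banach–Mazur distance to the symmetrization -/

/-- If `K ⊆ -s K`, and so `K / s ⊆ -K ⊆ s K`, then from the first step on the iterated means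
of `K` and `-K` lie between `d K` and `s d K`, and between `e K` and `s e K`, where the product
`d e = 1 / s` does not depend on the step. -/
theorem exists_iterMeans_neg_sandwich (hn : 1 ≤ n) (p : ℝ) (hK : IsBody₀ K) (hs : 0 < s)
    (h1 : K ⊆ s • -K) (i : ℕ) :
    ∃ d e : ℝ, 0 < d ∧ 0 < e ∧ d * e = s⁻¹ ∧
      (d • K ⊆ (iterMeans p K (-K) (i + 1)).1 ∧
        (iterMeans p K (-K) (i + 1)).1 ⊆ (s * d) • K) ∧
      e • K ⊆ (iterMeans p K (-K) (i + 1)).2 ∧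
        (iterMeans p K (-K) (i + 1)).2 ⊆ (s * e) • K := by
  have hi := inv_pos.2 hs
  have h2 : -K ⊆ s • K := by
    rw [Set.neg_subset, ← Set.smul_set_neg]
    exact h1
  have h3 : s⁻¹ • K ⊆ -K := by
    rw [Set.smul_set_subset_iff₀ hi.ne', inv_inv]
    exact h1
  induction i with
  | zero =>
    have hm := pMean_pos p one_pos hs
    -- `d = pMean p 1 s⁻¹` comes from `K / s ⊆ -K`, and `s d = pMean p 1 s` from `-K ⊆ s K`.
    refine ⟨s⁻¹ * pMean p 1 s, (pMean p 1 s)⁻¹, by positivity, by positivity,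
      by field_simp, ⟨?_, ?_⟩, ?_, ?_⟩
    · rw [← pMean_one_inv p hs, ← upperMean_smul_self p hK one_pos hi, one_smul]
      exact upperMean_mono p hK (hK.smul hi) hK hK.neg subset_rfl h3
    · rw [mul_inv_cancel_left₀ hs.ne', ← upperMean_smul_self p hK one_pos hs, one_smul]
      exact upperMean_mono p hK hK.neg hK (hK.smul hs) subset_rfl h2
    · have h : (pMean p 1 s)⁻¹ = (pMean (- -p) 1⁻¹ s⁻¹⁻¹)⁻¹ := by simp
      rw [h, ← lowerMean_smul_self hn (-p) hK one_pos hi, one_smul]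
      exact lowerMean_mono hn (-p) hK (hK.smul hi) hK hK.neg subset_rfl h3
    · have h : s * (pMean p 1 s)⁻¹ = (pMean (- -p) 1⁻¹ s⁻¹)⁻¹ := by
        rw [neg_neg, inv_one, pMean_one_inv p hs, mul_inv, inv_inv]
      rw [h, ← lowerMean_smul_self hn (-p) hK one_pos hs, one_smul]
      exact lowerMean_mono hn (-p) hK hK.neg hK (hK.smul hs) subset_rfl h2
  | succ i ih =>
    obtain ⟨d, e, hd, he, hde, ⟨u1, u2⟩, v1, v2⟩ := ih
    obtain ⟨hU, hV⟩ := isBody₀_iterMeans hn p hK hK.neg (i + 1)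
    have hsd := mul_pos hs hd
    have hse := mul_pos hs he
    have hm := pMean_pos p (inv_pos.2 hd) (inv_pos.2 he)
    refine ⟨pMean p d e, (pMean p d⁻¹ e⁻¹)⁻¹, pMean_pos p hd he, inv_pos.2 hm,
      by rw [pMean_mul_inv_pMean_inv p hd he, hde], ⟨?_, ?_⟩, ?_, ?_⟩
    · rw [← upperMean_smul_self p hK hd he]
      exact upperMean_mono p (hK.smul hd) (hK.smul he) hU hV u1 v1
    · rw [← pMean_mul p hs hd.le he.le, ← upperMean_smul_self p hK hsd hse]
      exact upperMean_mono p hU hV (hK.smul hsd) (hK.smul hse) u2 v2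
    · have h := lowerMean_smul_self hn (-p) hK hd he
      rw [neg_neg] at h
      rw [← h]
      exact lowerMean_mono hn (-p) (hK.smul hd) (hK.smul he) hU hV u1 v1
    · have h := lowerMean_smul_self hn (-p) hK hsd hse
      rw [neg_neg, mul_inv, mul_inv, pMean_mul p hi (inv_pos.2 hd).le (inv_pos.2 he).le, mul_inv,
        inv_inv] at h
      rw [← h]
      exact lowerMean_mono hn (-p) hU hV (hK.smul hsd) (hK.smul hse) u2 v2

/-- At each step one of the two means contains `K / √s`, and the other one lies in `√s K`. Both
inclusions are inherited by the limit. -/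
theorem geomMean_neg_sandwich (hn : 1 ≤ n) (p : ℝ) (hK : IsBody₀ K) (hs : 0 < s)
    (h1 : K ⊆ s • -K) :
    (√s)⁻¹ • K ⊆ geomMean p K (-K) ∧ geomMean p K (-K) ⊆ √s • K := by
  obtain ⟨hlim, r, hU, hV⟩ := geomMean_spec hn p hK hK.neg
  have hq : 0 < √s := Real.sqrt_pos.2 hs
  have hqq : √s * √s = s := Real.mul_self_sqrt hs.le
  have key : ∀ (i : ℕ) {d e : ℝ} {X Y : Set (E n)}, 0 < d → d * e = s⁻¹ → d ≤ e → e • K ⊆ Y →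
      X ⊆ (s * d) • K → Y ⊆ r i • geomMean p K (-K) → geomMean p K (-K) ⊆ r i • X →
      (√s)⁻¹ • K ⊆ r i • geomMean p K (-K) ∧ geomMean p K (-K) ⊆ r i • √s • K := by
    intro i d e X Y hd hde hle hY hX hYG hGX
    -- `√s d ≤ √s e` have product `1`, so `√s d ≤ 1 ≤ √s e`.
    have hone : (√s * d) * (√s * e) = 1 := by
      rw [mul_mul_mul_comm, hqq, hde, mul_inv_cancel₀ hs.ne']
    have hle' : √s * d ≤ √s * e := mul_le_mul_of_nonneg_left hle hq.le
    have hd0 : 0 < √s * d := mul_pos hq hd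
    have hd1 : √s * d ≤ 1 := by nlinarith
    have he1 : 1 ≤ √s * e := by nlinarith
    refine ⟨?_, ?_⟩
    · refine (hK.smul_subset_smul (inv_pos.2 hq) ?_).trans (hY.trans hYG)
      rwa [inv_le_iff_one_le_mul₀' hq]
    · refine hGX.trans (Set.smul_set_mono (hX.trans
        (hK.smul_subset_smul (mul_pos hs hd) ?_)))
      calc s * d = √s * (√s * d) := by rw [← mul_assoc, hqq]
        _ ≤ √s := mul_le_of_le_one_right hq.le hd1
  have hboth : ∀ i, (√s)⁻¹ • K ⊆ r (i + 1) • geomMean p K (-K) ∧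
      geomMean p K (-K) ⊆ r (i + 1) • √s • K := by
    intro i
    obtain ⟨d, e, hd, he, hde, ⟨u1, u2⟩, v1, v2⟩ :=
      exists_iterMeans_neg_sandwich hn p hK hs h1 i
    rcases le_total d e with h | h
    · exact key _ hd hde h v1 u2 (hV.subset _) (hU.superset _)
    · exact key _ he ((mul_comm e d).trans hde) h u1 v2 (hU.subset _) (hV.superset _)
  have hr := hU.tendsto.comp (tendsto_add_atTop_nat 1)
  exact ⟨hlim.isBody₀.subset_of_eventually_subset_smul hr (.of_forall fun i => (hboth i).1),
    (hK.smul hq).subset_of_eventually_subset_smul hr (.of_forall fun i => (hboth i).2)⟩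

/-- If a linear image of a symmetric set lies between translates of `K` and `r K`, reflecting it
in the origin shows that `K` lies in a translate of `-r K`. -/
theorem asymmetry_le_of_isZeroSymmetric (hG : IsZeroSymmetric G) (hr : 0 ≤ r)
    (A : E n ≃ₗ[ℝ] E n) (t₁ t₂ : E n) (h1 : K + {t₁} ⊆ A '' G) (h2 : A '' G ⊆ r • K + {t₂}) :
    asymmetry K ≤ r := by
  refine asymmetry_le_of_subset (t := -t₂ - t₁) hr fun x hx => ?_
  obtain ⟨g, hg, hgx⟩ := h1 (Set.add_mem_add hx rfl)
  have hg' : -g ∈ G := by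
    rw [hG] at hg
    exact hg
  obtain ⟨_, ⟨k, hk, rfl⟩, _, rfl, hk2⟩ := h2 (Set.mem_image_of_mem A hg')
  refine ⟨r • -k, ⟨-k, Set.neg_mem_neg.2 hk, rfl⟩, _, rfl, ?_⟩
  simp only [map_neg] at hk2
  rw [eq_neg_iff_add_eq_zero, hgx] at hk2
  simp only [smul_neg]
  rw [← sub_eq_zero, ← neg_eq_zero, ← hk2]
  abel

theorem banachMazurDist_geomMean_neg (hn : 1 ≤ n) (p : ℝ) (hK : IsBody₀ K)
    (h : IsMinkowskiCentered K) (hG : IsZeroSymmetric (geomMean p K (-K))) :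
    banachMazurDist K (geomMean p K (-K)) = asymmetry K := by
  have hs := asymmetry_pos hn hK h
  have hq : 0 < √(asymmetry K) := Real.sqrt_pos.2 hs
  obtain ⟨h1, h2⟩ := geomMean_neg_sandwich hn p hK hs (isMinkowskiCentered_iff.1 h)
  have hmem : asymmetry K ∈ {r : ℝ | 0 ≤ r ∧ ∃ (A : E n ≃ₗ[ℝ] E n) (t₁ t₂ : E n),
      K + {t₁} ⊆ A '' geomMean p K (-K) ∧ A '' geomMean p K (-K) ⊆ r • K + {t₂}} := by
    -- The homothety of factor `√s` maps the limit between `K` and `s K`.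
    refine ⟨hs.le, LinearEquiv.smulOfNeZero ℝ (E n) _ hq.ne', 0, 0, ?_, ?_⟩
    · rw [Set.singleton_zero, add_zero]
      exact (Set.smul_set_subset_iff₀ (inv_pos.2 hq).ne').1 h1 |>.trans
        (by rw [inv_inv]; exact subset_rfl)
    · rw [Set.singleton_zero, add_zero]
      have h3 : √(asymmetry K) • geomMean p K (-K) ⊆ √(asymmetry K) • √(asymmetry K) • K :=
        Set.smul_set_mono h2
      rw [smul_smul, Real.mul_self_sqrt hs.le] at h3
      exact h3
  refine le_antisymm (csInf_le ⟨0, fun _ hr => hr.1⟩ hmem) (le_csInf ⟨_, hmem⟩ ?_)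
  rintro r ⟨hr, A, t₁, t₂, hA1, hA2⟩
  exact asymmetry_le_of_isZeroSymmetric hG hr A t₁ t₂ hA1 hA2

end ConvexMeans

theorem mainTheorem9 (n : ℕ) (hn : 1 ≤ n) (p : ℝ) (K L : Set (ConvexMeans.E n))
    (hK : ConvexMeans.IsBody₀ K) (hL : ConvexMeans.IsBody₀ L) :
    -- the means exist: they are common Hausdorff limits
    ConvexMeans.IsCommonLimit p K L (ConvexMeans.geomMean p K L) ∧
    ConvexMeans.IsCommonLimit p K (-K) (ConvexMeans.geomMean p K (-K)) ∧
    -- symmetrization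
    ConvexMeans.IsZeroSymmetric (ConvexMeans.geomMean p K (-K)) ∧
    -- Banach-Mazur distance
    (ConvexMeans.IsMinkowskiCentered K →
      ConvexMeans.banachMazurDist K (ConvexMeans.geomMean p K (-K)) =
        ConvexMeans.asymmetry K) ∧
    -- asymmetry
    (ConvexMeans.IsMinkowskiCentered K → ConvexMeans.IsMinkowskiCentered L →
      ConvexMeans.asymmetry (ConvexMeans.geomMean p K L) ≤
          max (ConvexMeans.asymmetry K) (ConvexMeans.asymmetry L) ∧
      (ConvexMeans.asymmetry (ConvexMeans.geomMean p K L) =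
          max (ConvexMeans.asymmetry K) (ConvexMeans.asymmetry L) →
        ConvexMeans.IsMinkowskiCentered (ConvexMeans.geomMean p K L))) ∧
    (ConvexMeans.IsZeroSymmetric K → ConvexMeans.IsZeroSymmetric L →
      ConvexMeans.IsZeroSymmetric (ConvexMeans.geomMean p K L)) := by
  have hKL := ConvexMeans.geomMean_spec hn p hK hL
  have hKK := ConvexMeans.geomMean_spec hn p hK hK.neg
  have hsymm : ConvexMeans.IsZeroSymmetric (ConvexMeans.geomMean p K (-K)) := by
    obtain ⟨hlim, r, hU, -⟩ := hKK
    refine hU.isZeroSymmetric hlim.isBody₀ ?_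
    filter_upwards [eventually_ge_atTop 1] with i hi
    obtain ⟨j, rfl⟩ := Nat.exists_eq_add_of_le' hi
    exact (ConvexMeans.isZeroSymmetric_iterMeans_neg p K j).1
  refine ⟨hKL.1, hKK.1, hsymm,
    fun hc => ConvexMeans.banachMazurDist_geomMean_neg hn p hK hc hsymm, ?_, ?_⟩
  · intro hcK hcL
    set s := max (ConvexMeans.asymmetry K) (ConvexMeans.asymmetry L)
    have hsK := ConvexMeans.asymmetry_pos hn hK hcK
    have hsL := ConvexMeans.asymmetry_pos hn hL hcL
    have hs : 0 < s := lt_max_of_lt_left hsK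
    have h1 : K ⊆ s • -K := (ConvexMeans.isMinkowskiCentered_iff.1 hcK).trans
      (hK.neg.smul_subset_smul hsK (le_max_left _ _))
    have h2 : L ⊆ s • -L := (ConvexMeans.isMinkowskiCentered_iff.1 hcL).trans
      (hL.neg.smul_subset_smul hsL (le_max_right _ _))
    obtain ⟨hlim, r, hU, -⟩ := hKL
    have hG : ConvexMeans.geomMean p K L ⊆ s • -ConvexMeans.geomMean p K L :=
      hU.subset_smul_neg hlim.isBody₀ hs (.of_forall fun i =>
        (ConvexMeans.iterMeans_subset_smul_neg hn p hK hL hs h1 h2 i).1)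
    refine ⟨ConvexMeans.asymmetry_le_of_subset (t := 0) hs.le ?_, fun heq => ?_⟩
    · rwa [Set.singleton_zero, add_zero]
    · rwa [ConvexMeans.isMinkowskiCentered_iff, heq]
  · intro hsK hsL
    obtain ⟨hlim, r, hU, -⟩ := hKL
    exact hU.isZeroSymmetric hlim.isBody₀ (.of_forall fun i =>
      (ConvexMeans.isZeroSymmetric_iterMeans p hsK hsL i).1)
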